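/- **Setting.** Let $K, K' \subset \mathbb{R}^2$ be nonempty finite geometric simplicial complexes. For a direction $\omega \in S^1$ and a simplex $\alpha$ of $K$ or $K'$ with vertices $v_0,\dots,v_k$, let $I_\alpha(\omega) = \max_i \langle v_i, \omega\rangle$. The sublevel complexes $\{\alpha \in K : I_\alpha(\omega) \le a\}$ filter $K$; let $\mathrm{Dgm}_k(h^K_\omega)$ be the $k$-th persistence diagram of this filtration (simplicial homology over a fixed field), a finite multiset of points $(b,d)$ with $b<d\le\infty$, where the points with $d=\infty$ (essential points) represent the classes that never die. Fix one of two conventions: the essential points are kept, or they are discarded. Let $d_B$ be the bottleneck distance, i.e. the minimum over all partial matchings of the largest among the $L_\infty$-distances of matched points and the half-persistences $\tfrac12|d-b|$ of unmatched points (here $|\infty-\infty|=0$, distances between a finite and an infinite value are $\infty$, and the maximum of no terms is $0$). Fix a finite set $S$ of homological degrees (for instance $S=\{0,1\}$, or a single degree) and put $$H(\omega) = \max_{k\in S} d_B\big(\mathrm{Dgm}_k(h^K_\omega), \mathrm{Dgm}_k(h^{K'}_\omega)\big), \qquad d_\infty = \sup_{\omega\in S^1} H(\omega).$$ For two distinct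 simplices $\alpha,\sigma$ of the disjoint union $K \sqcup K'$, the *difference curve* $\Delta_{\alpha,\sigma} : S^1 \to \mathbb{R}$ is $|I_\alpha - I_\sigma|$ if $\alpha,\sigma$ belong to different complexes and $\tfrac12|I_\alpha - I_\sigma|$ if they belong to the same complex. Two difference curves *intersect* at $\omega$ if they have the same value at $\omega$ and either they cross there (on some one-sided neighbourhood of $\omega$ the first is strictly smaller than the second, and on some neighbourhood on the other side it is strictly larger), or $\omega$ is an endpoint of an interval of coincidence (they agree on a one-sided neighbourhood of $\omega$ and are nowhere equal on a punctured neighbourhood on the other side). Interior points of intervals of coincidence do not count. **Theorem (Events for $d_\infty$ in $\mathbb{R}^2$).** Assume $d_\infty < \infty$, and assume that $d_\infty > 0$ or that essential points are kept and $0 \in S$. Then the supremum $d_\infty$ is attained, and every direction $\omega^* \in S^1$ with $H(\omega^*) = d_\infty$ satisfies at least one of the following: 1. $\omega^*$ is a local maximum of some difference curve $\Delta_{\alpha,\sigma}$ with $\Delta_{\alpha,\sigma}(\omega^*) = d_\infty$; 2. two difference curves intersect at $\omega^*$, with common value $d_\infty$ there. -/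

import Mathlib

open Filter Topology
open scoped ENNReal

noncomputable section

namespace PHT

/-- The Euclidean plane. -/
abbrev Plane := EuclideanSpace ℝ (Fin 2)

/-- The circle of directions. -/
abbrev Dir := Metric.sphere (0 : Plane) 1

/-- The direction with angle `θ`. -/
def dir (θ : ℝ) : Dir :=
  ⟨!₂[Real.cos θ, Real.sin θ], by simp [EuclideanSpace.norm_eq]⟩

/-- Geometric simplicial complexes in the plane; `K.faces` is the set of simplices, a simplex being
the (nonempty) finite set of its vertices. -/
abbrev Complex2 := Geometry.SimplicialComplex ℝ Plane

/-! ### Simplicial homology over a field -/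

section Homology

variable (F : Type*) [Field F]

/-- Oriented simplicial boundary on formal combinations of finite vertex sets. Vertices are ordered
lexicographically, and `v ∈ σ` contributes `σ \ {v}` with sign `(-1) ^ #{w ∈ σ | w < v}`. The
boundary of a vertex is zero (homology is not reduced). -/
def boundary : (Finset Plane →₀ F) →ₗ[F] (Finset Plane →₀ F) :=
  open Classical in
  Finsupp.linearCombination F fun σ : Finset Plane =>
    if σ.card ≤ 1 then 0
    else ∑ v ∈ σ, Finsupp.single (σ.erase v)
      ((-1 : F) ^ (σ.filter fun w => toLex (WithLp.ofLp w) < toLex (WithLp.ofLp v)).card)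

/-- The `k`-chains of a set `L` of simplices. -/
def chains (L : Set (Finset Plane)) (k : ℕ) : Submodule F (Finset Plane →₀ F) :=
  Finsupp.supported F F {σ | σ ∈ L ∧ σ.card = k + 1}

/-- The `k`-cycles of `L`. -/
def cycles (L : Set (Finset Plane)) (k : ℕ) : Submodule F (Finset Plane →₀ F) :=
  chains F L k ⊓ LinearMap.ker (boundary F)

/-- The `k`-boundaries of `L`. -/
def boundaries (L : Set (Finset Plane)) (k : ℕ) : Submodule F (Finset Plane →₀ F) :=
  (chains F L (k + 1)).map (boundary F)

/-- The rank of the map `H_k(L) → H_k(M)` induced by an inclusion `L ⊆ M` of complexes: the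
dimension of the image of `Z_k(L)` modulo `B_k(M)`. -/
def persistentRank (L M : Set (Finset Plane)) (k : ℕ) : ℕ :=
  Module.finrank F ((cycles F L k).map (boundaries F M k).mkQ)

end Homology

/-! ### Insertion curves and the height filtration -/

/-- Insertion curve `I_α(ω) = max_{v ∈ α} ⟨v, ω⟩`. -/
def insertion (K : Complex2) (α : K.faces) (ω : Dir) : ℝ :=
  α.1.sup' (K.nonempty_of_mem_faces α.2) fun v => inner ℝ v (ω : Plane)

/-- The sublevel complex of all simplices of height `≤ a`. -/
def sublevel (K : Complex2) (ω : Dir) (a : ℝ) : Set (Finset Plane) :=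
  Subtype.val '' {α : K.faces | insertion K α ω ≤ a}

/-- The strict sublevel complex of all simplices of height `< a`. -/
def strictSublevel (K : Complex2) (ω : Dir) (a : ℝ) : Set (Finset Plane) :=
  Subtype.val '' {α : K.faces | insertion K α ω < a}

/-- The finite set of heights at which simplices enter the filtration. -/
def heights (K : Complex2) [Finite K.faces] (ω : Dir) : Finset ℝ :=
  (Set.finite_range fun α : K.faces => insertion K α ω).toFinset

/-! ### Persistence diagrams -/

/-- A point `(birth, death)`; essential classes have death `⊤ = ∞`. -/
abbrev Pt := ℝ × WithTop ℝ

section Diagram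

variable (F : Type*) [Field F] (K : Complex2)

/-- The number of `k`-dimensional classes born at height `b` and dying at height `d`. -/
def multiplicity (k : ℕ) (ω : Dir) (b d : ℝ) : ℕ :=
  ((persistentRank F (sublevel K ω b) (strictSublevel K ω d) k : ℤ)
    - persistentRank F (sublevel K ω b) (sublevel K ω d) k
    - persistentRank F (strictSublevel K ω b) (strictSublevel K ω d) k
    + persistentRank F (strictSublevel K ω b) (sublevel K ω d) k).toNat

/-- The number of `k`-dimensional classes born at height `b` that never die. -/
def essentialMultiplicity (k : ℕ) (ω : Dir) (b : ℝ) : ℕ :=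
  persistentRank F (sublevel K ω b) K.faces k - persistentRank F (strictSublevel K ω b) K.faces k

variable [Finite K.faces]

/-- The points of the `k`-th persistence diagram with finite death, as a multiset. -/
def finiteDiagram (k : ℕ) (ω : Dir) : Multiset Pt :=
  ∑ b ∈ heights K ω, ∑ d ∈ (heights K ω).filter (b < ·),
    Multiset.replicate (multiplicity F K k ω b d) ((b, (d : WithTop ℝ)) : Pt)

/-- The points of the `k`-th persistence diagram with death `∞`, as a multiset. -/
def essentialDiagram (k : ℕ) (ω : Dir) : Multiset Pt :=
  ∑ b ∈ heights K ω, Multiset.replicate (essentialMultiplicity F K k ω b) ((b, ⊤) : Pt)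

/-- The persistence diagram `Dgm_k(h_ω^K)`, with (`ess = true`) or without (`ess = false`) its
essential points. -/
def diagram (ess : Bool) (k : ℕ) (ω : Dir) : Multiset Pt :=
  if ess then finiteDiagram F K k ω + essentialDiagram F K k ω else finiteDiagram F K k ω

end Diagram

/-! ### Bottleneck distance -/

/-- Distance of two death times in `(-∞, ∞]`. -/
def deathDist : WithTop ℝ → WithTop ℝ → ℝ≥0∞
  | some x, some y => edist x y
  | none, none => 0
  | _, _ => ⊤

/-- The `L_∞` distance of two points. -/
def ptDist (p q : Pt) : ℝ≥0∞ := max (edist p.1 q.1) (deathDist p.2 q.2)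

/-- Half the persistence, i.e. the `L_∞` distance to the diagonal. -/
def diagDist : Pt → ℝ≥0∞
  | (b, some d) => ENNReal.ofReal (|d - b| / 2)
  | (_, none) => ⊤

/-- A partial matching between multisets: `pairs` are the matched pairs, `left` and `right` the
unmatched points. -/
structure PartialMatching (X Y : Multiset Pt) where
  pairs : Multiset (Pt × Pt)
  left : Multiset Pt
  right : Multiset Pt
  left_eq : X = pairs.map Prod.fst + left
  right_eq : Y = pairs.map Prod.snd + right

/-- The cost of a partial matching (the maximum of the empty family being `0`). -/
def PartialMatching.cost {X Y : Multiset Pt} (η : PartialMatching X Y) : ℝ≥0∞ :=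
  (η.pairs.map fun m => ptDist m.1 m.2).sup ⊔ (η.left.map diagDist).sup ⊔ (η.right.map diagDist).sup

/-- The bottleneck distance. -/
def bottleneck (X Y : Multiset Pt) : ℝ≥0∞ := ⨅ η : PartialMatching X Y, η.cost

section Distance

variable (F : Type*) [Field F] (K K' : Complex2) [Finite K.faces] [Finite K'.faces]

/-- `H(ω)`: the bottleneck distance, as the largest one over the homological degrees in `S`. -/
def H (ess : Bool) (S : Finset ℕ) (ω : Dir) : ℝ≥0∞ :=
  S.sup fun k => bottleneck (diagram F K ess k ω) (diagram F K' ess k ω)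

/-- `d_∞`: the supremum of `H` over all directions. -/
def dInf (ess : Bool) (S : Finset ℕ) : ℝ≥0∞ := ⨆ ω : Dir, H F K K' ess S ω

end Distance

/-! ### Difference curves and their intersections -/

/-- Difference curve `Δ_{p,q}` of two simplices of the disjoint union of `K` and `K'`. -/
def diffCurve (K K' : Complex2) (p q : K.faces ⊕ K'.faces) (ω : Dir) : ℝ :=
  match p, q with
  | .inl α, .inl β => |insertion K α ω - insertion K β ω| / 2
  | .inl α, .inr τ => |insertion K α ω - insertion K' τ ω|
  | .inr σ, .inl β => |insertion K' σ ω - insertion K β ω|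
  | .inr σ, .inr τ => |insertion K' σ ω - insertion K' τ ω| / 2

/-- Near the angle `θ`, the curve `f` is strictly below `g` before `θ` and strictly above after. -/
def CrossesUp (f g : Dir → ℝ) (θ : ℝ) : Prop :=
  (∀ᶠ t in 𝓝[<] θ, f (dir t) < g (dir t)) ∧ (∀ᶠ t in 𝓝[>] θ, g (dir t) < f (dir t))

/-- The angle `θ` is an endpoint of an interval on which `f` and `g` coincide: they agree on one
side of `θ` and are nowhere equal on the other side, near `θ`. -/
def OverlapEndpoint (f g : Dir → ℝ) (θ : ℝ) : Prop :=
  ((∀ᶠ t in 𝓝[<] θ, f (dir t) = g (dir t)) ∧ (∀ᶠ t in 𝓝[>] θ, f (dir t) ≠ g (dir t))) ∨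
  ((∀ᶠ t in 𝓝[<] θ, f (dir t) ≠ g (dir t)) ∧ (∀ᶠ t in 𝓝[>] θ, f (dir t) = g (dir t)))

/-- The curves `f` and `g` intersect at `ω`: they have the same value there, and either they cross
or `ω` is an endpoint of an overlap. Interior points of an overlap do not count; in particular a
curve does not intersect itself. -/
def IntersectAt (f g : Dir → ℝ) (ω : Dir) : Prop :=
  f ω = g ω ∧ ∃ θ : ℝ, dir θ = ω ∧ (CrossesUp f g θ ∨ CrossesUp g f θ ∨ OverlapEndpoint f g θ)

end PHT

end

/-!
The theorem is local at a maximizing direction `ω*`, and rests on two facts about `H`.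

*Continuity* (`continuousAt_H`). For `ω` near `ω₀` the height filtration in direction `ω` refines
the one in direction `ω₀`: simplices that are strictly ordered at `ω₀` keep their order, and only
ties are broken. Multiplicities are mixed second differences of persistent ranks, so they telescope
when heights merge, and the diagram at `ω₀` arises from the one at `ω` by moving every point to the
merged heights and dropping the points that reach the diagonal (`Refines.diagram_eq`). Such a
displacement changes the bottleneck distance by at most twice its size (`bottleneck_filterMap_le`,
`bottleneck_le_filterMap`). Here a partial matching is read as a relation between multisets padded
with copies of the diagonal (`Close`, `pad`), which turns both estimates into a triangle inequality.
As the circle is compact, the supremum is attained.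

*Values* (`H_mem_diffValues`). The cost of a matching is `0`, `∞` or the value of a difference curve
of two distinct simplices, and finitely many values make the infimum over matchings a minimum. Hence
a finite positive `H(ω)` is the value of a difference curve. If essential points are kept and `0`
is among the degrees, then the same holds for the value `0`, because the component of a lowest vertex
gives an essential point (`exists_essential_mem_diagram`), which has to be matched.

Along the angle, difference curves agree on either side of a point with analytic functions, so two
of them, or one of them and a constant, are ordered on a one-sided neighbourhood
(`AnalyticAlong.le_or_lt`). By the two facts there is a difference curve `f` through the maximum
that stays below it to the left of `ω*`, and a curve `g` through the maximum that stays below it to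
the right (`exists_diffCurve_le`). If `g ≤ f` on the left, then `g` has a local maximum at `ω*`; if
`f ≤ g` on the right, then `f` has one; otherwise `f < g` on the left and `g < f` on the right, so
that the curves cross.
-/

noncomputable section

namespace PHT

/-! ### Persistent ranks -/

section Rank

theorem finrank_map_mkQ_add_finrank_inf {F V : Type*} [Field F] [AddCommGroup V] [Module F V]
    (Z B : Submodule F V) [FiniteDimensional F Z] :
    Module.finrank F (Z.map B.mkQ) + Module.finrank F (Z ⊓ B : Submodule F V)
      = Module.finrank F Z := by
  have h := (B.mkQ.domRestrict Z).finrank_range_add_finrank_ker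
  rw [LinearMap.range_domRestrict, LinearMap.ker_domRestrict, Submodule.ker_mkQ,
    ← Submodule.finrank_map_subtype_eq, Submodule.map_comap_subtype] at h
  exact h

/-- The gain in the rank of `Z` modulo `B` from enlarging `Z` decreases when `B` grows; the reason is
that `(Z₁ ⊓ B₂) ⊔ (Z₂ ⊓ B₁) ≤ Z₂ ⊓ B₂`. -/
theorem finrank_map_mkQ_submodular {F V : Type*} [Field F] [AddCommGroup V] [Module F V]
    {Z₁ Z₂ B₁ B₂ : Submodule F V} [FiniteDimensional F Z₂] (hZ : Z₁ ≤ Z₂) (hB : B₁ ≤ B₂) :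
    Module.finrank F (Z₂.map B₂.mkQ) + Module.finrank F (Z₁.map B₁.mkQ)
      ≤ Module.finrank F (Z₂.map B₁.mkQ) + Module.finrank F (Z₁.map B₂.mkQ) := by
  have hfin : ∀ {W : Submodule F V}, W ≤ Z₂ → FiniteDimensional F W := fun h =>
    Submodule.finiteDimensional_of_le h
  have := hfin hZ
  have := hfin (inf_le_left : Z₂ ⊓ B₂ ≤ Z₂)
  have := hfin (inf_le_left : Z₂ ⊓ B₁ ≤ Z₂)
  have := hfin (inf_le_left.trans hZ : Z₁ ⊓ B₂ ≤ Z₂)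
  have h22 := finrank_map_mkQ_add_finrank_inf Z₂ B₂
  have h21 := finrank_map_mkQ_add_finrank_inf Z₂ B₁
  have h12 := finrank_map_mkQ_add_finrank_inf Z₁ B₂
  have h11 := finrank_map_mkQ_add_finrank_inf Z₁ B₁
  have hsum := Submodule.finrank_sup_add_finrank_inf_eq (Z₁ ⊓ B₂) (Z₂ ⊓ B₁)
  have hinf : (Z₁ ⊓ B₂) ⊓ (Z₂ ⊓ B₁) = Z₁ ⊓ B₁ :=
    le_antisymm (le_inf (inf_le_left.trans inf_le_left) (inf_le_right.trans inf_le_right))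
      (le_inf (inf_le_inf_left _ hB) (inf_le_inf_right _ hZ))
  have hsup : Module.finrank F ((Z₁ ⊓ B₂) ⊔ (Z₂ ⊓ B₁) : Submodule F V)
      ≤ Module.finrank F (Z₂ ⊓ B₂ : Submodule F V) :=
    Submodule.finrank_mono (sup_le (inf_le_inf_right _ hZ) (inf_le_inf_left _ hB))
  rw [hinf] at hsum
  omega

variable (F : Type*) [Field F]

theorem chains_mono {L M : Set (Finset Plane)} (h : L ⊆ M) (k : ℕ) : chains F L k ≤ chains F M k :=
  Finsupp.supported_mono fun _ hσ => ⟨h hσ.1, hσ.2⟩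

theorem cycles_mono {L M : Set (Finset Plane)} (h : L ⊆ M) (k : ℕ) : cycles F L k ≤ cycles F M k :=
  inf_le_inf_right _ (chains_mono F h k)

theorem boundaries_mono {L M : Set (Finset Plane)} (h : L ⊆ M) (k : ℕ) :
    boundaries F L k ≤ boundaries F M k :=
  Submodule.map_mono (chains_mono F h (k + 1))

theorem finiteDimensional_cycles {L : Set (Finset Plane)} (hL : L.Finite) (k : ℕ) :
    FiniteDimensional F (cycles F L k) := by
  have : Finite {σ : Finset Plane | σ ∈ L ∧ σ.card = k + 1} := hL.subset fun _ h => h.1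
  have : FiniteDimensional F (chains F L k) :=
    Module.Finite.equiv (Finsupp.supportedEquivFinsupp (M := F) (R := F) _).symm
  exact Submodule.finiteDimensional_of_le inf_le_left

theorem persistentRank_mono_left {L₁ L₂ : Set (Finset Plane)} (M : Set (Finset Plane))
    (h : L₁ ⊆ L₂) (hfin : L₂.Finite) (k : ℕ) :
    persistentRank F L₁ M k ≤ persistentRank F L₂ M k := by
  have := finiteDimensional_cycles F hfin k
  exact Submodule.finrank_mono (Submodule.map_mono (cycles_mono F h k))

end Rank

/-! ### Sublevel complexes and multiplicities -/

section Sublevel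

variable (K : Complex2)

theorem strictSublevel_subset (ω : Dir) (a : ℝ) : strictSublevel K ω a ⊆ sublevel K ω a :=
  Set.image_mono fun α (h : insertion K α ω < a) => show insertion K α ω ≤ a from h.le

theorem sublevel_subset_faces (ω : Dir) (a : ℝ) : sublevel K ω a ⊆ K.faces := by
  rintro _ ⟨α, -, rfl⟩
  exact α.2

variable (F : Type*) [Field F] [Finite K.faces]

theorem sublevel_finite (ω : Dir) (a : ℝ) : (sublevel K ω a).Finite :=
  (Set.toFinite K.faces).subset (sublevel_subset_faces K ω a)

/-- The alternating sum of persistent ranks defining a multiplicity is nonnegative, so that the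
truncation `Int.toNat` in its definition has no effect. -/
theorem coe_multiplicity (k : ℕ) (ω : Dir) (b d : ℝ) :
    (multiplicity F K k ω b d : ℤ) =
      (persistentRank F (sublevel K ω b) (strictSublevel K ω d) k : ℤ)
      - persistentRank F (sublevel K ω b) (sublevel K ω d) k
      - persistentRank F (strictSublevel K ω b) (strictSublevel K ω d) k
      + persistentRank F (strictSublevel K ω b) (sublevel K ω d) k := by
  have := finiteDimensional_cycles F (sublevel_finite K ω b) k
  have h := finrank_map_mkQ_submodular
    (cycles_mono F (strictSublevel_subset K ω b) k)
    (boundaries_mono F (strictSublevel_subset K ω d) k)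
  apply Int.toNat_of_nonneg
  unfold persistentRank
  omega

theorem coe_essentialMultiplicity (k : ℕ) (ω : Dir) (b : ℝ) :
    (essentialMultiplicity F K k ω b : ℤ) =
      (persistentRank F (sublevel K ω b) K.faces k : ℤ)
        - persistentRank F (strictSublevel K ω b) K.faces k :=
  Int.ofNat_sub (persistentRank_mono_left F _ (strictSublevel_subset K ω b)
    (sublevel_finite K ω b) k)

theorem mem_heights {ω : Dir} {x : ℝ} : x ∈ heights K ω ↔ ∃ α : K.faces, insertion K α ω = x := by
  simp [heights]

end Sublevel

/-! ### Diagrams of a refined filtration -/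

section Coarsening

/-- Telescoping of the increments of `G` along the initial segments of a finite set of reals. -/
theorem sum_sub_filter_le_filter_lt (A : Finset ℝ) (G : Finset ℝ → ℤ) :
    ∑ x ∈ A, (G (A.filter (· ≤ x)) - G (A.filter (· < x))) = G A - G ∅ := by
  induction A using Finset.induction_on_max with
  | empty => simp
  | insert a s hs ih =>
    have ha : a ∉ s := fun h => lt_irrefl _ (hs a h)
    rw [Finset.sum_insert ha]
    have h1 : (insert a s).filter (· ≤ a) = insert a s :=
      Finset.filter_true_of_mem fun x hx => by
        rcases Finset.mem_insert.1 hx with rfl | hx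
        exacts [le_rfl, (hs x hx).le]
    have h2 : (insert a s).filter (· < a) = s := by
      rw [Finset.filter_insert, if_neg (lt_irrefl a), Finset.filter_true_of_mem hs]
    have h3 : ∀ x ∈ s, G ((insert a s).filter (· ≤ x)) - G ((insert a s).filter (· < x))
        = G (s.filter (· ≤ x)) - G (s.filter (· < x)) := fun x hx => by
      rw [Finset.filter_insert, if_neg (hs x hx).not_ge, Finset.filter_insert,
        if_neg (hs x hx).le.not_gt]
    rw [h1, h2, Finset.sum_congr rfl h3, ih]
    ring

/-- The filtration of `K` in direction `ω` refines the one in direction `ω₀`: simplices that are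
strictly ordered at `ω₀` are ordered in the same way at `ω`, and `f` sends a height at `ω` to
the height at `ω₀` of the simplices that enter there. -/
structure Refines (K : Complex2) (ω ω₀ : Dir) (f : ℝ → ℝ) : Prop where
  lt_of_lt : ∀ α β : K.faces, insertion K α ω₀ < insertion K β ω₀ →
    insertion K α ω < insertion K β ω
  apply_insertion : ∀ α : K.faces, f (insertion K α ω) = insertion K α ω₀

/-- Simplices that enter together at `ω` also enter together at `ω₀`, so the heights at `ω` determine
the heights at `ω₀`. -/
theorem exists_refines {K : Complex2} {ω ω₀ : Dir}
    (h : ∀ α β : K.faces, insertion K α ω₀ < insertion K β ω₀ →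
      insertion K α ω < insertion K β ω) : ∃ f, Refines K ω ω₀ f := by
  classical
  refine ⟨fun x => if hx : ∃ α : K.faces, insertion K α ω = x then insertion K hx.choose ω₀ else 0,
    h, fun α => ?_⟩
  have hx : ∃ β : K.faces, insertion K β ω = insertion K α ω := ⟨α, rfl⟩
  simp only [dif_pos hx]
  have hc := hx.choose_spec
  rcases lt_trichotomy (insertion K hx.choose ω₀) (insertion K α ω₀) with h' | h' | h'
  · exact absurd hc (h _ _ h').ne
  · exact h'
  · exact absurd hc (h _ _ h').ne'

variable {K : Complex2} [Finite K.faces] {ω ω₀ : Dir} {f : ℝ → ℝ}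

theorem Refines.lt {x y : ℝ} (h : Refines K ω ω₀ f) (hx : x ∈ heights K ω) (hy : y ∈ heights K ω)
    (hxy : f x < f y) : x < y := by
  obtain ⟨α, rfl⟩ := (mem_heights K).1 hx
  obtain ⟨β, rfl⟩ := (mem_heights K).1 hy
  rw [h.apply_insertion, h.apply_insertion] at hxy
  exact h.lt_of_lt _ _ hxy

theorem Refines.le {x y : ℝ} (h : Refines K ω ω₀ f) (hx : x ∈ heights K ω) (hy : y ∈ heights K ω)
    (hxy : x ≤ y) : f x ≤ f y :=
  le_of_not_gt fun h' => (h.lt hy hx h').not_ge hxy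

theorem Refines.mapsTo {x : ℝ} (h : Refines K ω ω₀ f) (hx : x ∈ heights K ω) :
    f x ∈ heights K ω₀ := by
  obtain ⟨α, rfl⟩ := (mem_heights K).1 hx
  exact (mem_heights K).2 ⟨α, (h.apply_insertion α).symm⟩

theorem Refines.sum_isLowerSet (h : Refines K ω ω₀ f) {U : Set ℝ} [DecidablePred (· ∈ U)]
    (hU : IsLowerSet U) (g : Set (Finset Plane) → ℤ) :
    ∑ x ∈ (heights K ω).filter (fun x => f x ∈ U), (g (sublevel K ω x) - g (strictSublevel K ω x))
      = g (Subtype.val '' {α : K.faces | insertion K α ω₀ ∈ U}) - g ∅ := by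
  set A := (heights K ω).filter (fun x => f x ∈ U) with hA
  have key := sum_sub_filter_le_filter_lt A
    (fun T => g (Subtype.val '' {α : K.faces | insertion K α ω ∈ T}))
  have memA : ∀ α : K.faces, insertion K α ω ∈ A ↔ insertion K α ω₀ ∈ U := fun α => by
    rw [hA, Finset.mem_filter, h.apply_insertion, and_iff_right ((mem_heights K).2 ⟨α, rfl⟩)]
  have low : ∀ x ∈ A, ∀ α : K.faces, insertion K α ω ≤ x → insertion K α ω ∈ A := by
    intro x hx α hα
    rw [memA, ← h.apply_insertion]
    have hx' := Finset.mem_filter.1 hx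
    exact hU (h.le ((mem_heights K).2 ⟨α, rfl⟩) hx'.1 hα) hx'.2
  simp only [memA, Finset.notMem_empty, Set.ofPred_false, Set.image_empty] at key
  rw [← key]
  refine Finset.sum_congr rfl fun x hx => ?_
  have e1 : {α : K.faces | insertion K α ω ∈ A.filter (· ≤ x)} = {α | insertion K α ω ≤ x} := by
    ext α
    simpa using low x hx α
  have e2 : {α : K.faces | insertion K α ω ∈ A.filter (· < x)} = {α | insertion K α ω < x} := by
    ext α
    simpa using fun hα : insertion K α ω < x => low x hx α hα.le
  rw [e1, e2]
  rfl

/-- Increments of any function of the sublevel complexes over the heights merging into `b` add up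
to its increment at `b`. -/
theorem Refines.sum_fiber (h : Refines K ω ω₀ f) (g : Set (Finset Plane) → ℤ) (b : ℝ) :
    ∑ x ∈ (heights K ω).filter (fun x => f x = b), (g (sublevel K ω x) - g (strictSublevel K ω x))
      = g (sublevel K ω₀ b) - g (strictSublevel K ω₀ b) := by
  classical
  have h1 := h.sum_isLowerSet (isLowerSet_Iic b) g
  have h2 := h.sum_isLowerSet (isLowerSet_Iio b) g
  have hd : (heights K ω).filter (fun x => f x ∈ Set.Iic b)
      = ((heights K ω).filter (fun x => f x ∈ Set.Iio b)).disjUnion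
        ((heights K ω).filter (fun x => f x = b))
        (Finset.disjoint_filter.2 fun x _ hx hx' => (ne_of_lt hx) hx') := by
    ext x
    simp only [Finset.mem_filter, Finset.mem_disjUnion, Set.mem_Iic, Set.mem_Iio, le_iff_lt_or_eq,
      and_or_left]
  rw [hd, Finset.sum_disjUnion, h2] at h1
  have e1 : Subtype.val '' {α : K.faces | insertion K α ω₀ ∈ Set.Iic b} = sublevel K ω₀ b := rfl
  have e2 : Subtype.val '' {α : K.faces | insertion K α ω₀ ∈ Set.Iio b} = strictSublevel K ω₀ b :=
    rfl
  rw [e1, e2] at h1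
  linarith

variable (F : Type*) [Field F]

/-- The multiplicity of a point is the sum of the multiplicities of the points that merge into it:
telescoping in births and in deaths. -/
theorem Refines.sum_multiplicity (h : Refines K ω ω₀ f) (k : ℕ) (b d : ℝ) :
    ∑ x ∈ (heights K ω).filter (fun x => f x = b), ∑ y ∈ (heights K ω).filter (fun y => f y = d),
      multiplicity F K k ω x y = multiplicity F K k ω₀ b d := by
  zify
  simp only [coe_multiplicity]
  have inner : ∀ x, ∑ y ∈ (heights K ω).filter (fun y => f y = d),
      ((persistentRank F (sublevel K ω x) (strictSublevel K ω y) k : ℤ)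
      - persistentRank F (sublevel K ω x) (sublevel K ω y) k
      - persistentRank F (strictSublevel K ω x) (strictSublevel K ω y) k
      + persistentRank F (strictSublevel K ω x) (sublevel K ω y) k)
      = ((persistentRank F (sublevel K ω x) (strictSublevel K ω₀ d) k : ℤ)
          - persistentRank F (sublevel K ω x) (sublevel K ω₀ d) k)
        - ((persistentRank F (strictSublevel K ω x) (strictSublevel K ω₀ d) k : ℤ)
          - persistentRank F (strictSublevel K ω x) (sublevel K ω₀ d) k) := fun x => by
    have := h.sum_fiber (fun M => (persistentRank F (strictSublevel K ω x) M k : ℤ)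
      - persistentRank F (sublevel K ω x) M k) d
    rw [← sub_eq_zero] at this ⊢
    rw [← this]
    simp only [Finset.sum_sub_distrib, Finset.sum_add_distrib]
    ring
  rw [Finset.sum_congr rfl fun x _ => inner x]
  rw [h.sum_fiber (fun L => (persistentRank F L (strictSublevel K ω₀ d) k : ℤ)
          - persistentRank F L (sublevel K ω₀ d) k) b]
  ring

theorem Refines.sum_essentialMultiplicity (h : Refines K ω ω₀ f) (k : ℕ) (b : ℝ) :
    ∑ x ∈ (heights K ω).filter (fun x => f x = b), essentialMultiplicity F K k ω x
      = essentialMultiplicity F K k ω₀ b := by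
  zify
  simp only [coe_essentialMultiplicity]
  exact h.sum_fiber (fun L => (persistentRank F L K.faces k : ℤ)) b

theorem replicate_sum {ι α : Type*} (s : Finset ι) (n : ι → ℕ) (a : α) :
    Multiset.replicate (∑ i ∈ s, n i) a = ∑ i ∈ s, Multiset.replicate (n i) a :=
  map_sum (Multiset.replicateAddMonoidHom a) n s

/-- Apply `f` to both coordinates of a point. -/
def Pt.map (f : ℝ → ℝ) (p : Pt) : Pt := (f p.1, WithTop.map f p.2)

/-- Apply `f` to both coordinates of a point of a diagram, and forget the point (value `none`) if
it lands on the diagonal. -/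
def Pt.collapse (f : ℝ → ℝ) (p : Pt) : Option Pt :=
  open Classical in if ((Pt.map f p).1 : WithTop ℝ) = (Pt.map f p).2 then none
    else some (Pt.map f p)

theorem filterMap_sum {ι α β : Type*} (g : α → Option β) (s : Finset ι) (X : ι → Multiset α) :
    (∑ i ∈ s, X i).filterMap g = ∑ i ∈ s, (X i).filterMap g :=
  map_sum (⟨⟨Multiset.filterMap g, rfl⟩, fun x y => Multiset.filterMap_add g x y⟩ :
    Multiset α →+ Multiset β) X s

theorem filterMap_replicate {α β : Type*} (g : α → Option β) (n : ℕ) (a : α) :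
    (Multiset.replicate n a).filterMap g = (g a).elim 0 (Multiset.replicate n) := by
  induction n with
  | zero => cases g a <;> simp
  | succ n ih =>
    rw [Multiset.replicate_succ]
    cases h : g a with
    | none => rw [Multiset.filterMap_cons_none _ _ h, ih, h]; rfl
    | some b => rw [Multiset.filterMap_cons_some _ _ _ h, ih, h]; simp

/-- The heights at `ω₀` partition the pairs of heights at `ω`, and the pairs with `f x = f y` are the
ones that `Pt.collapse` discards. -/
theorem Refines.finiteDiagram_eq (h : Refines K ω ω₀ f) (k : ℕ) :
    finiteDiagram F K k ω₀ = (finiteDiagram F K k ω).filterMap (Pt.collapse f) := by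
  classical
  have R : (finiteDiagram F K k ω).filterMap (Pt.collapse f) =
      ∑ x ∈ heights K ω, ∑ y ∈ heights K ω, if f x < f y then
        Multiset.replicate (multiplicity F K k ω x y) ((f x, (f y : WithTop ℝ)) : Pt) else 0 := by
    rw [finiteDiagram, filterMap_sum]
    refine Finset.sum_congr rfl fun x hx => ?_
    rw [filterMap_sum, Finset.sum_filter]
    refine Finset.sum_congr rfl fun y hy => ?_
    rw [filterMap_replicate, Pt.collapse, Pt.map]
    by_cases hf : f x < f y
    · rw [if_pos hf, if_pos (h.lt hx hy hf), if_neg]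
      · rfl
      · simpa using hf.ne
    · rw [if_neg hf]
      split_ifs with h1 h2
      · rfl
      · exact absurd (lt_of_le_of_ne (h.le hx hy h1.le) (by simpa using h2)) hf
      · rfl
  rw [R, finiteDiagram, ← Finset.sum_fiberwise_of_maps_to (fun x hx => h.mapsTo hx)]
  refine Finset.sum_congr rfl fun b _ => ?_
  rw [Finset.sum_congr rfl fun x _ =>
    (Finset.sum_fiberwise_of_maps_to (fun y hy => h.mapsTo hy) _).symm, Finset.sum_comm,
    Finset.sum_filter]
  refine Finset.sum_congr rfl fun d _ => ?_
  rw [← h.sum_multiplicity F k b d, replicate_sum]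
  split_ifs with hbd
  · refine Finset.sum_congr rfl fun x hx => ?_
    rw [replicate_sum]
    refine Finset.sum_congr rfl fun y hy => ?_
    rw [(Finset.mem_filter.1 hx).2, (Finset.mem_filter.1 hy).2, if_pos hbd]
  · refine (Finset.sum_eq_zero fun x hx => Finset.sum_eq_zero fun y hy => ?_).symm
    rw [(Finset.mem_filter.1 hx).2, (Finset.mem_filter.1 hy).2, if_neg hbd]

theorem Refines.essentialDiagram_eq (h : Refines K ω ω₀ f) (k : ℕ) :
    essentialDiagram F K k ω₀ = (essentialDiagram F K k ω).filterMap (Pt.collapse f) := by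
  classical
  rw [essentialDiagram, essentialDiagram, filterMap_sum,
    ← Finset.sum_fiberwise_of_maps_to (fun x hx => h.mapsTo hx)]
  refine Finset.sum_congr rfl fun b _ => ?_
  rw [← h.sum_essentialMultiplicity F k b, replicate_sum]
  refine Finset.sum_congr rfl fun x hx => ?_
  rw [filterMap_replicate, Pt.collapse, Pt.map, if_neg]
  · rw [(Finset.mem_filter.1 hx).2]; rfl
  · exact WithTop.coe_ne_top

/-- Passing to a coarser filtration moves each point of the diagram to the merged heights and drops
the points that land on the diagonal. -/
theorem Refines.diagram_eq (h : Refines K ω ω₀ f) (ess : Bool) (k : ℕ) :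
    diagram F K ess k ω₀ = (diagram F K ess k ω).filterMap (Pt.collapse f) := by
  cases ess
  · exact h.finiteDiagram_eq F k
  · change _ + _ = Multiset.filterMap _ (_ + _)
    rw [Multiset.filterMap_add, ← h.finiteDiagram_eq F, ← h.essentialDiagram_eq F]

end Coarsening

/-! ### Bottleneck distance under displacement of points -/

section Close

theorem deathDist_comm (x y : WithTop ℝ) : deathDist x y = deathDist y x := by
  cases x <;> cases y <;> first | rfl | exact edist_comm _ _

theorem deathDist_triangle (x y z : WithTop ℝ) :
    deathDist x z ≤ deathDist x y + deathDist y z := by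
  cases x <;> cases y <;> cases z <;>
    first
    | exact edist_triangle _ _ _
    | simp [deathDist]

theorem ptDist_comm (p q : Pt) : ptDist p q = ptDist q p := by
  rw [ptDist, ptDist, edist_comm, deathDist_comm]

theorem ptDist_triangle (p q r : Pt) : ptDist p r ≤ ptDist p q + ptDist q r :=
  max_le
    ((edist_triangle _ q.1 _).trans (add_le_add (le_max_left _ _) (le_max_left _ _)))
    ((deathDist_triangle _ q.2 _).trans (add_le_add (le_max_right _ _) (le_max_right _ _)))

theorem edist_real (x y : ℝ) : edist x y = ENNReal.ofReal |x - y| := by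
  rw [edist_dist, Real.dist_eq]

theorem diagDist_le_ptDist_add (p q : Pt) : diagDist p ≤ ptDist p q + diagDist q := by
  obtain ⟨b, d⟩ := p
  obtain ⟨b', d'⟩ := q
  cases d with
  | top =>
    cases d' with
    | top => exact le_add_left le_rfl
    | coe d' => exact le_add_right (le_max_of_le_right le_rfl)
  | coe d =>
    cases d' with
    | top => exact le_add_left le_top
    | coe d' =>
      have h : diagDist (b, (d : WithTop ℝ)) ≤
          max (ENNReal.ofReal |b - b'|) (ENNReal.ofReal |d - d'|) + ENNReal.ofReal (|d' - b'| / 2) := by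
        rw [← ENNReal.ofReal_max, ← ENNReal.ofReal_add (by positivity) (by positivity)]
        refine ENNReal.ofReal_le_ofReal ?_
        have h1 := le_max_left |b - b'| |d - d'|
        have h2 := le_max_right |b - b'| |d - d'|
        have h3 : |d - b| ≤ |d - d'| + |d' - b'| + |b - b'| := by
          rw [abs_sub_comm b b']
          exact (abs_sub_le d b' b).trans (add_le_add_left (abs_sub_le d d' b') _)
        linarith
      rw [← edist_real, ← edist_real] at h
      exact h

/-- Points at distance at most `c` in the plane with its diagonal collapsed to one point `none`. Two
points off the diagonal are also close if both are close to the diagonal; this is what makes the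
triangle inequality `Close.trans` hold. -/
def Close (c : ℝ≥0∞) : Option Pt → Option Pt → Prop
  | some p, some q => ptDist p q ≤ c ∨ (diagDist p ≤ c ∧ diagDist q ≤ c)
  | some p, none => diagDist p ≤ c
  | none, some q => diagDist q ≤ c
  | none, none => True

theorem Close.symm {c : ℝ≥0∞} : ∀ {u v : Option Pt}, Close c u v → Close c v u
  | some p, some q, h => by
    rcases h with h | h
    · exact Or.inl (by rwa [ptDist_comm])
    · exact Or.inr h.symm
  | some _, none, h => h
  | none, some _, h => h
  | none, none, _ => trivial

theorem Close.trans {c e : ℝ≥0∞} :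
    ∀ {u v w : Option Pt}, Close c u v → Close e v w → Close (c + e) u w
  | some p, some q, some r, h, h' => by
    rcases h with h | h <;> rcases h' with h' | h'
    · exact Or.inl ((ptDist_triangle p q r).trans (add_le_add h h'))
    · exact Or.inr ⟨(diagDist_le_ptDist_add p q).trans (add_le_add h h'.1),
        h'.2.trans le_add_self⟩
    · refine Or.inr ⟨h.1.trans le_self_add, (diagDist_le_ptDist_add r q).trans ?_⟩
      rw [add_comm, ptDist_comm]
      exact add_le_add h.2 h'
    · exact Or.inr ⟨h.1.trans le_self_add, h'.2.trans le_add_self⟩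
  | some p, some q, none, h, h' => by
    rcases h with h | h
    · exact (diagDist_le_ptDist_add p q).trans (add_le_add h h')
    · exact h.1.trans le_self_add
  | some _, none, some _, h, h' => Or.inr ⟨le_trans h le_self_add, le_trans h' le_add_self⟩
  | some _, none, none, h, _ => le_trans h le_self_add
  | none, some q, some r, h, h' => by
    rcases h' with h' | h'
    · refine (diagDist_le_ptDist_add r q).trans ?_
      rw [add_comm, ptDist_comm]
      exact add_le_add h h'
    · exact h'.2.trans le_add_self
  | none, none, some _, _, h' => le_trans h' le_add_self
  | none, _, none, _, _ => trivial

/-- A multiset of points, padded with `n` copies of the diagonal. -/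
def pad (X : Multiset Pt) (n : ℕ) : Multiset (Option Pt) := X.map some + Multiset.replicate n none

theorem filterMap_pad (X : Multiset Pt) (n : ℕ) : (pad X n).filterMap id = X := by
  rw [pad, Multiset.filterMap_add, Multiset.filterMap_map, filterMap_replicate]
  simp

theorem pad_add (X : Multiset Pt) (m n : ℕ) :
    pad X (m + n) = pad X m + Multiset.replicate n none := by
  rw [pad, pad, Multiset.replicate_add, add_assoc]

theorem PartialMatching.cost_le_iff {X Y : Multiset Pt} (η : PartialMatching X Y) (c : ℝ≥0∞) :
    η.cost ≤ c ↔ (∀ m ∈ η.pairs, ptDist m.1 m.2 ≤ c) ∧ (∀ p ∈ η.left, diagDist p ≤ c) ∧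
      (∀ q ∈ η.right, diagDist q ≤ c) := by
  simp only [PartialMatching.cost, sup_le_iff, Multiset.sup_le, Multiset.forall_mem_map_iff,
    and_assoc]

/-- Two points related only through the diagonal are left unmatched. -/
theorem exists_matching_of_rel {c : ℝ≥0∞} {A B : Multiset (Option Pt)}
    (h : Multiset.Rel (Close c) A B) :
    ∃ η : PartialMatching (A.filterMap id) (B.filterMap id), η.cost ≤ c := by
  suffices ∃ P : Multiset (Pt × Pt), ∃ L R : Multiset Pt,
      A.filterMap id = P.map Prod.fst + L ∧ B.filterMap id = P.map Prod.snd + R ∧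
      (∀ m ∈ P, ptDist m.1 m.2 ≤ c) ∧ (∀ p ∈ L, diagDist p ≤ c) ∧ (∀ q ∈ R, diagDist q ≤ c) by
    obtain ⟨P, L, R, hA, hB, h⟩ := this
    exact ⟨⟨P, L, R, hA, hB⟩, (PartialMatching.cost_le_iff _ c).2 h⟩
  induction h with
  | zero => exact ⟨0, 0, 0, rfl, rfl, by simp⟩
  | @cons a b A B hab _ ih =>
    obtain ⟨P, L, R, hA, hB, hp, hl, hr⟩ := ih
    have none_cons : ∀ M : Multiset (Option Pt), (none ::ₘ M).filterMap id = M.filterMap id :=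
      fun M => Multiset.filterMap_cons_none _ _ rfl
    have some_cons : ∀ p (M : Multiset (Option Pt)),
        (some p ::ₘ M).filterMap id = p ::ₘ M.filterMap id :=
      fun p M => Multiset.filterMap_cons_some _ _ _ rfl
    rcases a with _ | p <;> rcases b with _ | q <;> simp only [none_cons, some_cons, hA, hB]
    · exact ⟨P, L, R, rfl, rfl, hp, hl, hr⟩
    · exact ⟨P, L, q ::ₘ R, rfl, by rw [Multiset.add_cons], hp, hl,
        Multiset.forall_mem_cons.2 ⟨hab, hr⟩⟩
    · exact ⟨P, p ::ₘ L, R, by rw [Multiset.add_cons], rfl, hp,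
        Multiset.forall_mem_cons.2 ⟨hab, hl⟩, hr⟩
    · rcases hab with hab | hab
      · exact ⟨(p, q) ::ₘ P, L, R, by rw [Multiset.map_cons, Multiset.cons_add],
          by rw [Multiset.map_cons, Multiset.cons_add],
          Multiset.forall_mem_cons.2 ⟨hab, hp⟩, hl, hr⟩
      · exact ⟨P, p ::ₘ L, q ::ₘ R, by rw [Multiset.add_cons], by rw [Multiset.add_cons], hp,
          Multiset.forall_mem_cons.2 ⟨hab.1, hl⟩, Multiset.forall_mem_cons.2 ⟨hab.2, hr⟩⟩

/-- Each unmatched point is paired with one of the added copies of the diagonal. -/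
theorem PartialMatching.rel_pad {X Y : Multiset Pt} (η : PartialMatching X Y) {c : ℝ≥0∞}
    (h : η.cost ≤ c) :
    Multiset.Rel (Close c) (pad X η.right.card) (pad Y η.left.card) := by
  obtain ⟨hp, hl, hr⟩ := (η.cost_le_iff c).1 h
  have e1 : pad X η.right.card = (η.pairs.map fun m => some m.1) +
      (η.left.map some + η.right.map fun _ => none) := by
    have hX := congrArg (Multiset.map some) η.left_eq
    rw [Multiset.map_add, Multiset.map_map] at hX
    rw [pad, Multiset.map_const', ← add_assoc, hX]
    rfl
  have e2 : pad Y η.left.card = (η.pairs.map fun m => some m.2) +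
      ((η.left.map fun _ => none) + η.right.map some) := by
    have hY := congrArg (Multiset.map some) η.right_eq
    rw [Multiset.map_add, Multiset.map_map] at hY
    rw [pad, Multiset.map_const', add_comm (Multiset.replicate _ _), ← add_assoc, hY]
    rfl
  rw [e1, e2]
  refine Multiset.Rel.add (Multiset.rel_map.2 (Multiset.rel_refl_of_refl_on fun m hm => ?_))
    (Multiset.Rel.add (Multiset.rel_map.2 (Multiset.rel_refl_of_refl_on fun p hp => ?_))
      (Multiset.rel_map.2 (Multiset.rel_refl_of_refl_on fun q hq => ?_)))
  · exact Or.inl (hp m hm)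
  · exact hl p hp
  · exact hr q hq

/-- The points dropped by `g` become further copies of the diagonal. -/
theorem exists_map_pad_eq (X : Multiset Pt) (g : Pt → Option Pt) :
    ∃ N, ∀ m, (pad X m).map (fun u => u.bind g) = pad (X.filterMap g) (m + N) := by
  induction X using Multiset.induction_on with
  | empty => exact ⟨0, fun m => by simp [pad]⟩
  | cons p X ih =>
    obtain ⟨N, hN⟩ := ih
    have e : ∀ m, (pad (p ::ₘ X) m).map (fun u => u.bind g)
        = g p ::ₘ (pad X m).map (fun u => u.bind g) := fun m => by simp [pad]
    cases hg : g p with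
    | none =>
      refine ⟨N + 1, fun m => ?_⟩
      rw [e, hN, hg, Multiset.filterMap_cons_none _ _ hg, pad, pad, ← add_assoc,
        Multiset.replicate_succ, Multiset.add_cons]
    | some q =>
      refine ⟨N, fun m => ?_⟩
      rw [e, hN, hg, Multiset.filterMap_cons_some _ _ _ hg, pad, pad, Multiset.map_cons,
        Multiset.cons_add]

theorem rel_replicate_none (c : ℝ≥0∞) (n : ℕ) :
    Multiset.Rel (Close c) (Multiset.replicate n none) (Multiset.replicate n none) :=
  Multiset.rel_refl_of_refl_on fun a ha => by
    rw [Multiset.eq_of_mem_replicate ha]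
    trivial

theorem mem_pad_close {X : Multiset Pt} {g : Pt → Option Pt} {ε : ℝ≥0∞}
    (hg : ∀ p ∈ X, Close ε (some p) (g p)) {m : ℕ} {u : Option Pt} (hu : u ∈ pad X m) :
    Close ε u (u.bind g) := by
  rcases Multiset.mem_add.1 hu with h | h
  · obtain ⟨p, hp, rfl⟩ := Multiset.mem_map.1 h
    exact hg p hp
  · rw [Multiset.eq_of_mem_replicate h]
    trivial

variable {X Y : Multiset Pt} {g g' : Pt → Option Pt} {ε : ℝ≥0∞}

/-- Moving every point by at most `ε`, possibly into the diagonal, increases the bottleneck distance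
by at most `2ε`. -/
theorem bottleneck_filterMap_le (hg : ∀ p ∈ X, Close ε (some p) (g p))
    (hg' : ∀ p ∈ Y, Close ε (some p) (g' p)) :
    bottleneck (X.filterMap g) (Y.filterMap g') ≤ bottleneck X Y + 2 * ε := by
  rw [bottleneck, bottleneck, ENNReal.iInf_add]
  refine le_iInf fun η => ?_
  obtain ⟨N, hN⟩ := exists_map_pad_eq X g
  obtain ⟨N', hN'⟩ := exists_map_pad_eq Y g'
  have h := (η.rel_pad le_rfl).mono (p := fun u v => Close (η.cost + 2 * ε) (u.bind g) (v.bind g'))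
    fun u hu v hv huv => by
      rw [two_mul, add_comm η.cost, add_assoc, add_comm ε η.cost]
      exact (mem_pad_close hg hu).symm.trans (huv.trans (mem_pad_close hg' hv))
  have h' := exists_matching_of_rel (Multiset.rel_map.2 h)
  rw [hN, hN', filterMap_pad, filterMap_pad] at h'
  obtain ⟨ζ, hζ⟩ := h'
  exact (iInf_le _ ζ).trans hζ

/-- Moving every point by at most `ε`, possibly into the diagonal, decreases the bottleneck distance
by at most `2ε`. -/
theorem bottleneck_le_filterMap (hg : ∀ p ∈ X, Close ε (some p) (g p))
    (hg' : ∀ p ∈ Y, Close ε (some p) (g' p)) :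
    bottleneck X Y ≤ bottleneck (X.filterMap g) (Y.filterMap g') + 2 * ε := by
  rw [bottleneck, bottleneck, ENNReal.iInf_add]
  refine le_iInf fun η => ?_
  obtain ⟨N, hN⟩ := exists_map_pad_eq X g
  obtain ⟨N', hN'⟩ := exists_map_pad_eq Y g'
  have h := (η.rel_pad le_rfl).add (rel_replicate_none η.cost (N + N'))
  rw [← pad_add, ← pad_add, add_comm N N', ← add_assoc, ← hN, add_comm N' N, ← add_assoc, ← hN',
    Multiset.rel_map] at h
  have h' := exists_matching_of_rel <| h.mono (p := fun u v => Close (η.cost + 2 * ε) u v)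
    fun u hu v hv huv => by
      rw [two_mul, add_comm η.cost, add_assoc, add_comm ε η.cost]
      exact (mem_pad_close hg hu).trans (huv.trans (mem_pad_close hg' hv).symm)
  rw [filterMap_pad, filterMap_pad] at h'
  obtain ⟨ζ, hζ⟩ := h'
  exact (iInf_le _ ζ).trans hζ

end Close

/-! ### Continuity of insertion and difference curves -/

section Insertion

theorem continuous_insertion (K : Complex2) (α : K.faces) : Continuous (insertion K α) := by
  unfold insertion
  refine Continuous.finset_sup'_apply _ fun v _ => ?_
  fun_prop

theorem continuous_diffCurve (K K' : Complex2) (p q : K.faces ⊕ K'.faces) :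
    Continuous (diffCurve K K' p q) := by
  have h := continuous_insertion K
  have h' := continuous_insertion K'
  rcases p with α | σ <;> rcases q with β | τ <;> unfold diffCurve
  · exact ((h α).sub (h β)).abs.div_const 2
  · exact ((h α).sub (h' τ)).abs
  · exact ((h' σ).sub (h β)).abs
  · exact ((h' σ).sub (h' τ)).abs.div_const 2

theorem diffCurve_nonneg (K K' : Complex2) (p q : K.faces ⊕ K'.faces) (ω : Dir) :
    0 ≤ diffCurve K K' p q ω := by
  rcases p with α | σ <;> rcases q with β | τ <;> unfold diffCurve <;> positivity

theorem eventually_lt_of_insertion_lt (K : Complex2) [Finite K.faces] (ω₀ : Dir) :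
    ∀ᶠ ω in 𝓝 ω₀, ∀ α β : K.faces, insertion K α ω₀ < insertion K β ω₀ →
      insertion K α ω < insertion K β ω := by
  refine eventually_all.2 fun α => eventually_all.2 fun β => eventually_imp_distrib_left.2 fun h => ?_
  exact (continuous_insertion K α).continuousAt.eventually_lt
    (continuous_insertion K β).continuousAt h

theorem eventually_edist_insertion_le (K : Complex2) [Finite K.faces] (ω₀ : Dir) {ε : ℝ≥0∞}
    (hε : 0 < ε) : ∀ᶠ ω in 𝓝 ω₀, ∀ α : K.faces, edist (insertion K α ω) (insertion K α ω₀) ≤ ε :=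
  eventually_all.2 fun α =>
    (continuous_insertion K α).continuousAt.eventually (Metric.closedEBall_mem_nhds _ hε)

end Insertion

/-! ### Continuity of the bottleneck distance in the direction -/

section Diagram

variable (F : Type*) [Field F] (K K' : Complex2) [Finite K.faces] [Finite K'.faces]

theorem mem_diagram {ess : Bool} {k : ℕ} {ω : Dir} {p : Pt} (hp : p ∈ diagram F K ess k ω) :
    (∃ α : K.faces, insertion K α ω = p.1) ∧
      (p.2 = ⊤ ∨ ∃ β : K.faces, p.1 < insertion K β ω ∧ p.2 = (insertion K β ω : ℝ)) := by
  have hf : p ∈ finiteDiagram F K k ω → (∃ α : K.faces, insertion K α ω = p.1) ∧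
      (p.2 = ⊤ ∨ ∃ β : K.faces, p.1 < insertion K β ω ∧ p.2 = (insertion K β ω : ℝ)) := by
    intro h
    simp only [finiteDiagram, Multiset.mem_sum] at h
    obtain ⟨b, hb, d, hd, h⟩ := h
    obtain ⟨hd, hbd⟩ := Finset.mem_filter.1 hd
    obtain ⟨β, rfl⟩ := (mem_heights K).1 hd
    rw [Multiset.eq_of_mem_replicate h]
    exact ⟨(mem_heights K).1 hb, Or.inr ⟨β, hbd, rfl⟩⟩
  cases ess
  · exact hf hp
  · rcases Multiset.mem_add.1 hp with h | h
    · exact hf h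
    · simp only [essentialDiagram, Multiset.mem_sum] at h
      obtain ⟨b, hb, h⟩ := h
      rw [Multiset.eq_of_mem_replicate h]
      exact ⟨(mem_heights K).1 hb, Or.inl rfl⟩

variable {F K K'}

/-- When all heights move by at most `ε`, so do the points of the diagram; a point that is dropped is
within `ε` of the diagonal. -/
theorem Refines.close_collapse {ω ω₀ : Dir} {f : ℝ → ℝ} (h : Refines K ω ω₀ f) {ε : ℝ≥0∞}
    (hε : ∀ α : K.faces, edist (insertion K α ω) (insertion K α ω₀) ≤ ε) {ess : Bool} {k : ℕ}
    {p : Pt} (hp : p ∈ diagram F K ess k ω) : Close ε (some p) (Pt.collapse f p) := by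
  obtain ⟨⟨α, hα⟩, hd⟩ := mem_diagram F K hp
  obtain ⟨b, d⟩ := p
  dsimp only at hα hd
  subst hα
  have hmap : ptDist (insertion K α ω, d) (Pt.map f (insertion K α ω, d)) ≤ ε := by
    refine max_le ?_ ?_
    · rw [Pt.map, h.apply_insertion]
      exact hε α
    · rcases hd with rfl | ⟨β, -, rfl⟩
      · exact zero_le
      · change edist (insertion K β ω) (f (insertion K β ω)) ≤ ε
        rw [h.apply_insertion]
        exact hε β
  rw [Pt.collapse]
  split_ifs with hdiag
  · have h0 : diagDist (Pt.map f (insertion K α ω, d)) = 0 := by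
      obtain ⟨x, hx⟩ : ∃ x, Pt.map f (insertion K α ω, d) = x := ⟨_, rfl⟩
      rw [hx] at hdiag ⊢
      obtain ⟨x, y⟩ := x
      dsimp only at hdiag
      subst hdiag
      change ENNReal.ofReal (|x - x| / 2) = 0
      simp
    refine (diagDist_le_ptDist_add _ (Pt.map f (insertion K α ω, d))).trans ?_
    rw [h0, add_zero]
    exact hmap
  · exact Or.inl hmap

variable (F K K')

/-- Near `ω₀` the diagrams at `ω₀` are the collapsed diagrams at `ω`, with every point displaced by
little. -/
theorem continuousAt_H (ess : Bool) (S : Finset ℕ) (ω₀ : Dir) (hfin : H F K K' ess S ω₀ ≠ ⊤) :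
    ContinuousAt (H F K K' ess S) ω₀ := by
  refine (ENNReal.tendsto_nhds hfin).2 fun ε hε => ?_
  have hε2 : 0 < ε / 2 := ENNReal.half_pos hε.ne'
  filter_upwards [eventually_lt_of_insertion_lt K ω₀, eventually_lt_of_insertion_lt K' ω₀,
    eventually_edist_insertion_le K ω₀ hε2, eventually_edist_insertion_le K' ω₀ hε2]
    with ω hlt hlt' hd hd'
  obtain ⟨f, hf⟩ := exists_refines hlt
  obtain ⟨f', hf'⟩ := exists_refines hlt'
  have hc : ∀ k, ∀ p ∈ diagram F K ess k ω, Close (ε / 2) (some p) (Pt.collapse f p) :=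
    fun k p hp => hf.close_collapse hd hp
  have hc' : ∀ k, ∀ p ∈ diagram F K' ess k ω, Close (ε / 2) (some p) (Pt.collapse f' p) :=
    fun k p hp => hf'.close_collapse hd' hp
  have e2 : 2 * (ε / 2) = ε := ENNReal.mul_div_cancel two_ne_zero ENNReal.ofNat_ne_top
  constructor
  · rw [tsub_le_iff_right]
    refine Finset.sup_le fun k hk => ?_
    have h := bottleneck_filterMap_le (hc k) (hc' k)
    rw [← hf.diagram_eq F, ← hf'.diagram_eq F, e2] at h
    exact h.trans (add_le_add_left (Finset.le_sup (f := fun k =>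
      bottleneck (diagram F K ess k ω) (diagram F K' ess k ω)) hk) _)
  · refine Finset.sup_le fun k hk => ?_
    have h := bottleneck_le_filterMap (hc k) (hc' k)
    rw [← hf.diagram_eq F, ← hf'.diagram_eq F, e2] at h
    exact h.trans (add_le_add_left (Finset.le_sup (f := fun k =>
      bottleneck (diagram F K ess k ω₀) (diagram F K' ess k ω₀)) hk) _)

end Diagram

/-! ### Essential points in degree zero -/

section DegreeZero

variable (F : Type*) [Field F]

/-- The augmentation of the chain complex: the sum of the coefficients. -/
def augmentation : (Finset Plane →₀ F) →ₗ[F] F := Finsupp.linearCombination F fun _ => (1 : F)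

theorem augmentation_boundary_single {σ : Finset Plane} (hσ : σ.card = 2) (c : F) :
    augmentation F (boundary F (Finsupp.single σ c)) = 0 := by
  classical
  obtain ⟨v, w, hvw, rfl⟩ := Finset.card_eq_two.1 hσ
  have hlex : ∀ v w : Plane, v ≠ w →
      toLex (WithLp.ofLp v) < toLex (WithLp.ofLp w) ∨ toLex (WithLp.ofLp w) < toLex (WithLp.ofLp v) :=
    fun v w h => lt_or_gt_of_ne fun h' => h (WithLp.ofLp_injective 2 (toLex.injective h'))
  have hirr : ∀ v : Plane, ¬ toLex (WithLp.ofLp v) < toLex (WithLp.ofLp v) := fun v => lt_irrefl _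
  have hasymm : ∀ v w : Plane, toLex (WithLp.ofLp v) < toLex (WithLp.ofLp w) →
      ¬ toLex (WithLp.ofLp w) < toLex (WithLp.ofLp v) := fun v w h => lt_asymm h
  rw [boundary, Finsupp.linearCombination_single, if_neg (by rw [hσ]; decide), Finset.sum_pair hvw,
    map_smul, map_add, augmentation, Finsupp.linearCombination_single,
    Finsupp.linearCombination_single]
  rcases hlex v w hvw with h | h <;>
    simp [Finset.filter_insert, Finset.filter_singleton, h, hirr, hasymm _ _ h]

theorem augmentation_eq_zero_of_mem_boundaries {L : Set (Finset Plane)} {x : Finset Plane →₀ F}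
    (hx : x ∈ boundaries F L 0) : augmentation F x = 0 := by
  obtain ⟨y, hy, rfl⟩ := hx
  rw [← Finsupp.sum_single y, Finsupp.sum, map_sum, map_sum]
  exact Finset.sum_eq_zero fun σ hσ =>
    augmentation_boundary_single F ((Finsupp.mem_supported F y).1 hy hσ).2 _

/-- A vertex has augmentation `1`, hence is not a boundary. -/
theorem persistentRank_zero_pos {L M : Set (Finset Plane)} (hL : L.Finite) {v : Plane}
    (hv : {v} ∈ L) : 0 < persistentRank F L M 0 := by
  have := finiteDimensional_cycles F hL 0
  rw [persistentRank, Module.finrank_pos_iff_exists_ne_zero]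
  have hz : Finsupp.single {v} (1 : F) ∈ cycles F L 0 := by
    refine ⟨(Finsupp.mem_supported F _).2 fun σ hσ => ?_, ?_⟩
    · have : σ = {v} := by simpa using Finsupp.support_single_subset hσ
      subst this
      exact ⟨hv, by simp⟩
    · change boundary F _ = 0
      rw [boundary, Finsupp.linearCombination_single]
      simp
  refine ⟨⟨_, Submodule.mem_map_of_mem hz⟩, fun h => ?_⟩
  have h' := augmentation_eq_zero_of_mem_boundaries F
    ((Submodule.Quotient.mk_eq_zero _).1 (congrArg Subtype.val h))
  rw [augmentation, Finsupp.linearCombination_single] at h'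
  simp at h'

theorem persistentRank_empty (M : Set (Finset Plane)) (k : ℕ) : persistentRank F ∅ M k = 0 := by
  have : cycles F (∅ : Set (Finset Plane)) k = ⊥ := by
    rw [cycles, chains]
    simp
  rw [persistentRank, this, Submodule.map_bot, finrank_bot]

variable (K : Complex2) [Finite K.faces]

/-- The component of a lowest vertex never dies. -/
theorem exists_essential_mem_diagram (hK : K.faces.Nonempty) (ω : Dir) :
    ∃ b : ℝ, ((b, ⊤) : Pt) ∈ diagram F K true 0 ω := by
  have : Nonempty K.faces := hK.to_subtype
  obtain ⟨α, hα⟩ := Finite.exists_min fun α : K.faces => insertion K α ω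
  refine ⟨insertion K α ω, Multiset.mem_add.2 (Or.inr ?_)⟩
  rw [essentialDiagram, Multiset.mem_sum]
  refine ⟨_, (mem_heights K).2 ⟨α, rfl⟩, ?_⟩
  rw [Multiset.mem_replicate]
  refine ⟨?_, rfl⟩
  have hempty : strictSublevel K ω (insertion K α ω) = ∅ := by
    rw [strictSublevel, Set.image_eq_empty]
    exact Set.eq_empty_of_forall_notMem fun β hβ => (hα β).not_gt hβ
  obtain ⟨v, hv⟩ := K.nonempty_of_mem_faces α.2
  have hvK : ({v} : Finset Plane) ∈ K.faces :=
    K.down_closed α.2 (Finset.singleton_subset_iff.2 hv) (Finset.singleton_nonempty v)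
  have hvL : ({v} : Finset Plane) ∈ sublevel K ω (insertion K α ω) := by
    refine ⟨⟨{v}, hvK⟩, ?_, rfl⟩
    change insertion K ⟨{v}, hvK⟩ ω ≤ _
    simp only [insertion, Finset.sup'_singleton]
    exact Finset.le_sup' (fun v : Plane => inner ℝ v (ω : Plane)) hv
  rw [essentialMultiplicity, hempty, persistentRank_empty, tsub_zero]
  exact (persistentRank_zero_pos F (sublevel_finite K ω _) hvL).ne'

end DegreeZero

/-! ### Values of the bottleneck distance -/

section Values

variable (K K' : Complex2)

/-- The values at `ω` of the difference curves of pairs of distinct simplices. -/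
def diffValues (ω : Dir) : Set ℝ≥0∞ :=
  {x | ∃ p q : K.faces ⊕ K'.faces, p ≠ q ∧ ENNReal.ofReal (diffCurve K K' p q ω) = x}

theorem finite_diffValues [Finite K.faces] [Finite K'.faces] (ω : Dir) :
    (diffValues K K' ω).Finite := by
  refine (Set.finite_range fun x : (K.faces ⊕ K'.faces) × (K.faces ⊕ K'.faces) =>
    ENNReal.ofReal (diffCurve K K' x.1 x.2 ω)).subset ?_
  rintro _ ⟨p, q, -, rfl⟩
  exact ⟨(p, q), rfl⟩

variable {K K'}

theorem edist_insertion_mem_diffValues (α : K.faces) (σ : K'.faces) (ω : Dir) :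
    edist (insertion K α ω) (insertion K' σ ω) ∈ diffValues K K' ω :=
  ⟨.inl α, .inr σ, Sum.inl_ne_inr, (edist_real _ _).symm⟩

theorem multiset_sup_mem {T : Set ℝ≥0∞} (h0 : 0 ∈ T) (s : Multiset ℝ≥0∞) (hs : ∀ x ∈ s, x ∈ T) :
    s.sup ∈ T := by
  induction s using Multiset.induction_on with
  | empty => exact h0
  | cons a s ih =>
    rw [Multiset.forall_mem_cons] at hs
    rw [Multiset.sup_cons]
    rcases max_choice a s.sup with h | h
    · exact h.symm ▸ hs.1
    · exact h.symm ▸ ih hs.2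

theorem max_mem {T : Set ℝ≥0∞} {x y : ℝ≥0∞} (hx : x ∈ T) (hy : y ∈ T) : max x y ∈ T := by
  rcases max_choice x y with h | h <;> rw [h] <;> assumption

variable {F : Type*} [Field F] {ess : Bool} {k : ℕ} {ω : Dir}

theorem diagDist_left_mem_diffValues [Finite K.faces] {p : Pt}
    (hp : p ∈ diagram F K ess k ω) :
    diagDist p ∈ insert ⊤ (diffValues K K' ω) := by
  obtain ⟨⟨α, hα⟩, hd⟩ := mem_diagram F K hp
  obtain ⟨b, d⟩ := p
  dsimp only at hα hd
  subst hα
  rcases hd with rfl | ⟨β, hβ, rfl⟩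
  · exact Or.inl rfl
  · exact Or.inr ⟨.inl β, .inl α, fun h => hβ.ne' (by rw [Sum.inl.inj h]), rfl⟩

theorem diagDist_right_mem_diffValues [Finite K'.faces] {p : Pt}
    (hp : p ∈ diagram F K' ess k ω) :
    diagDist p ∈ insert ⊤ (diffValues K K' ω) := by
  obtain ⟨⟨α, hα⟩, hd⟩ := mem_diagram F K' hp
  obtain ⟨b, d⟩ := p
  dsimp only at hα hd
  subst hα
  rcases hd with rfl | ⟨β, hβ, rfl⟩
  · exact Or.inl rfl
  · exact Or.inr ⟨.inr β, .inr α, fun h => hβ.ne' (by rw [Sum.inr.inj h]), rfl⟩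

theorem PartialMatching.mem_of_mem_pairs {X Y : Multiset Pt} (η : PartialMatching X Y)
    {m : Pt × Pt} (hm : m ∈ η.pairs) : m.1 ∈ X ∧ m.2 ∈ Y := by
  have h1 := Multiset.mem_add.2 (Or.inl (Multiset.mem_map_of_mem Prod.fst hm) (b := m.1 ∈ η.left))
  have h2 := Multiset.mem_add.2 (Or.inl (Multiset.mem_map_of_mem Prod.snd hm) (b := m.2 ∈ η.right))
  rw [← η.left_eq] at h1
  rw [← η.right_eq] at h2
  exact ⟨h1, h2⟩

theorem PartialMatching.mem_of_mem_left {X Y : Multiset Pt} (η : PartialMatching X Y)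
    {p : Pt} (hp : p ∈ η.left) : p ∈ X := by
  have h := Multiset.mem_add.2 (Or.inr hp (a := p ∈ η.pairs.map Prod.fst))
  rwa [← η.left_eq] at h

theorem PartialMatching.mem_of_mem_right {X Y : Multiset Pt} (η : PartialMatching X Y)
    {p : Pt} (hp : p ∈ η.right) : p ∈ Y := by
  have h := Multiset.mem_add.2 (Or.inr hp (a := p ∈ η.pairs.map Prod.snd))
  rwa [← η.right_eq] at h

variable [Finite K.faces] [Finite K'.faces]

/-- The distance of two points is infinite, or a difference of two births or of two deaths. -/
theorem ptDist_mem_diffValues {p q : Pt} (hp : p ∈ diagram F K ess k ω)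
    (hq : q ∈ diagram F K' ess k ω) : ptDist p q ∈ insert ⊤ (diffValues K K' ω) := by
  obtain ⟨⟨α, hα⟩, hd⟩ := mem_diagram F K hp
  obtain ⟨⟨σ, hσ⟩, he⟩ := mem_diagram F K' hq
  obtain ⟨b, d⟩ := p
  obtain ⟨c, e⟩ := q
  dsimp only at hα hσ hd he
  subst hα hσ
  have hb := edist_insertion_mem_diffValues α σ ω
  rcases hd with rfl | ⟨β, -, rfl⟩ <;> rcases he with rfl | ⟨τ, -, rfl⟩
  · right
    rwa [show ptDist (insertion K α ω, ⊤) (insertion K' σ ω, ⊤)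
      = edist (insertion K α ω) (insertion K' σ ω) from max_eq_left zero_le]
  · exact Or.inl (max_eq_right le_top)
  · exact Or.inl (max_eq_right le_top)
  · exact Or.inr (max_mem hb (edist_insertion_mem_diffValues β τ ω))

theorem PartialMatching.cost_mem_diffValues
    (η : PartialMatching (diagram F K ess k ω) (diagram F K' ess k ω)) :
    η.cost ∈ insert 0 (insert ⊤ (diffValues K K' ω)) := by
  refine max_mem (max_mem ?_ ?_) ?_ <;> refine multiset_sup_mem (Set.mem_insert _ _) _ ?_ <;>
    rw [Multiset.forall_mem_map_iff]
  · exact fun m hm => Or.inr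
      (ptDist_mem_diffValues (η.mem_of_mem_pairs hm).1 (η.mem_of_mem_pairs hm).2)
  · exact fun p hp => Or.inr (diagDist_left_mem_diffValues (η.mem_of_mem_left hp))
  · exact fun p hp => Or.inr (diagDist_right_mem_diffValues (η.mem_of_mem_right hp))

/-- The infimum in the bottleneck distance of two diagrams is attained, since costs of matchings
take only finitely many values. -/
theorem exists_cost_eq_bottleneck :
    ∃ η : PartialMatching (diagram F K ess k ω) (diagram F K' ess k ω),
      η.cost = bottleneck (diagram F K ess k ω) (diagram F K' ess k ω) := by
  have hne : (Set.range (PartialMatching.cost (X := diagram F K ess k ω)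
      (Y := diagram F K' ess k ω))).Nonempty :=
    ⟨_, ⟨0, diagram F K ess k ω, diagram F K' ess k ω, by simp, by simp⟩, rfl⟩
  refine hne.csInf_mem ((((finite_diffValues K K' ω).insert ⊤).insert 0).subset ?_)
  rintro _ ⟨η, rfl⟩
  exact η.cost_mem_diffValues

/-- If essential points are kept, the degree-zero bottleneck distance is the value of a difference
curve even if it vanishes, as an essential point of `K` has to be matched. -/
theorem bottleneck_zero_mem_diffValues (hK : K.faces.Nonempty)
    (hfin : bottleneck (diagram F K true 0 ω) (diagram F K' true 0 ω) ≠ ⊤) :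
    bottleneck (diagram F K true 0 ω) (diagram F K' true 0 ω) ∈ diffValues K K' ω := by
  obtain ⟨η, hη⟩ := exists_cost_eq_bottleneck (F := F) (K := K) (K' := K') (ess := true) (k := 0)
    (ω := ω)
  rw [← hη] at hfin ⊢
  rcases η.cost_mem_diffValues with h0 | h | h
  · obtain ⟨b, hb⟩ := exists_essential_mem_diagram F K hK ω
    obtain ⟨hp, hl, -⟩ := (η.cost_le_iff _).1 le_rfl
    rw [η.left_eq] at hb
    rcases Multiset.mem_add.1 hb with hb | hb
    · obtain ⟨m, hm, -⟩ := Multiset.mem_map.1 hb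
      have hm0 : ptDist m.1 m.2 = 0 := le_antisymm (h0 ▸ hp m hm) zero_le
      have hmV := ptDist_mem_diffValues (η.mem_of_mem_pairs hm).1 (η.mem_of_mem_pairs hm).2
      rw [h0]
      rw [hm0] at hmV
      exact hmV.resolve_left ENNReal.zero_ne_top
    · exact absurd (top_le_iff.1 (hl _ hb)) hfin
  · exact absurd h hfin
  · exact h

/-- A finite value of `H` is the value of a difference curve, except possibly for the value `0` when
essential points of degree zero are not taken into account. -/
theorem H_mem_diffValues (hK : K.faces.Nonempty) {S : Finset ℕ} (hfin : H F K K' ess S ω ≠ ⊤)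
    (h : (ess = true ∧ 0 ∈ S) ∨ 0 < H F K K' ess S ω) :
    H F K K' ess S ω ∈ diffValues K K' ω := by
  have hle : ∀ k ∈ S, bottleneck (diagram F K ess k ω) (diagram F K' ess k ω) ≤ H F K K' ess S ω :=
    fun k hk => Finset.le_sup (f := fun k =>
      bottleneck (diagram F K ess k ω) (diagram F K' ess k ω)) hk
  have hmem : H F K K' ess S ω ∈ insert 0 (insert ⊤ (diffValues K K' ω)) := by
    rcases S.eq_empty_or_nonempty with rfl | hS
    · exact Or.inl rfl
    · obtain ⟨k, -, hk⟩ := S.exists_mem_eq_sup hS fun k =>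
        bottleneck (diagram F K ess k ω) (diagram F K' ess k ω)
      obtain ⟨η, hη⟩ := exists_cost_eq_bottleneck (F := F) (K := K) (K' := K') (ess := ess) (k := k)
        (ω := ω)
      rw [H, hk, ← hη]
      exact η.cost_mem_diffValues
  rcases hmem with h0 | ht | hV
  · rcases h with ⟨rfl, hS⟩ | hpos
    · have hb := hle 0 hS
      rw [h0] at hb ⊢
      have hb0 := le_antisymm hb zero_le
      have := bottleneck_zero_mem_diffValues (F := F) (K' := K') (ω := ω) hK
        (by rw [hb0]; exact ENNReal.zero_ne_top)
      rwa [hb0] at this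
    · exact absurd h0 hpos.ne'
  · exact absurd ht hfin
  · exact hV

end Values

/-! ### Angles and directions -/

section Angle

theorem continuous_dir : Continuous dir := by
  unfold dir
  fun_prop

theorem exists_dir_eq (ω : Dir) : ∃ θ, dir θ = ω := by
  have hω : ‖(ω : Plane)‖ = 1 := by simp
  set z : ℂ := ⟨(ω : Plane) 0, (ω : Plane) 1⟩ with hz
  have hz1 : ‖z‖ = 1 := by
    rw [← hω, EuclideanSpace.norm_eq, Complex.norm_def, Complex.normSq_apply, Fin.sum_univ_two,
      Real.norm_eq_abs, Real.norm_eq_abs, sq_abs, sq_abs, sq, sq]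
  have hz0 : z ≠ 0 := fun h => by simp [h] at hz1
  refine ⟨z.arg, Subtype.ext ?_⟩
  ext i
  fin_cases i
  · change Real.cos z.arg = z.re
    rw [Complex.cos_arg hz0, hz1, div_one]
  · change Real.sin z.arg = z.im
    rw [Complex.sin_arg, hz1, div_one]

/-- The inverse of `dir` near the angle `θ` is `ω ↦ θ + arcsin v`, where `v` is the second coordinate
of `ω` in the frame rotated by `θ`. -/
theorem eventually_nhds_dir {P : Dir → Prop} {θ : ℝ} (h : ∀ᶠ t in 𝓝 θ, P (dir t)) :
    ∀ᶠ ω in 𝓝 (dir θ), P ω := by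
  set v : Dir → ℝ := fun ω => (ω : Plane) 1 * Real.cos θ - (ω : Plane) 0 * Real.sin θ with hv
  set u : Dir → ℝ := fun ω => (ω : Plane) 0 * Real.cos θ + (ω : Plane) 1 * Real.sin θ with hu
  have hvc : Continuous v := by fun_prop
  have huc : Continuous u := by fun_prop
  have hv0 : v (dir θ) = 0 := by simp [hv, dir]; ring
  have hu0 : 0 < u (dir θ) := by
    have : u (dir θ) = 1 := by
      simp only [hu, dir]
      simpa [sq] using Real.cos_sq_add_sin_sq θ
    rw [this]
    exact one_pos
  have hτ : Tendsto (fun ω => θ + Real.arcsin (v ω)) (𝓝 (dir θ)) (𝓝 θ) := by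
    have : Continuous fun ω => θ + Real.arcsin (v ω) :=
      continuous_const.add (Real.continuous_arcsin.comp hvc)
    simpa [hv0] using this.tendsto (dir θ)
  filter_upwards [hτ.eventually h, huc.continuousAt.eventually (lt_mem_nhds hu0)] with ω hP hpos
  convert hP
  have hω : (ω : Plane) 0 ^ 2 + (ω : Plane) 1 ^ 2 = 1 := by
    have : ‖(ω : Plane)‖ = 1 := by simp
    rw [EuclideanSpace.norm_eq, Real.sqrt_eq_one, Fin.sum_univ_two] at this
    simpa using this
  have hθ := Real.cos_sq_add_sin_sq θ
  have huv : u ω ^ 2 + v ω ^ 2 = 1 := by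
    simp only [hu, hv]
    linear_combination ((ω : Plane) 0 ^ 2 + (ω : Plane) 1 ^ 2) * hθ + hω
  have hsin : Real.sin (Real.arcsin (v ω)) = v ω :=
    Real.sin_arcsin (by nlinarith) (by nlinarith)
  have hcos : Real.cos (Real.arcsin (v ω)) = u ω := by
    rw [Real.cos_arcsin, ← huv, add_sub_cancel_right, Real.sqrt_sq hpos.le]
  refine Subtype.ext ?_
  ext i
  fin_cases i
  · change (ω : Plane) 0 = Real.cos (θ + Real.arcsin (v ω))
    rw [Real.cos_add, hsin, hcos]
    linear_combination (-(ω : Plane) 0) * hθ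
  · change (ω : Plane) 1 = Real.sin (θ + Real.arcsin (v ω))
    rw [Real.sin_add, hsin, hcos]
    linear_combination (-(ω : Plane) 1) * hθ

/-- Local maxima on the circle can be detected on the two sides of an angle. -/
theorem isLocalMax_dir {f : Dir → ℝ} {θ : ℝ}
    (hl : ∀ᶠ t in 𝓝[<] θ, f (dir t) ≤ f (dir θ)) (hr : ∀ᶠ t in 𝓝[>] θ, f (dir t) ≤ f (dir θ)) :
    IsLocalMax f (dir θ) := by
  refine eventually_nhds_dir (P := fun ω => f ω ≤ f (dir θ)) ?_
  rw [← nhdsNE_sup_pure, ← nhdsLT_sup_nhdsGT, eventually_sup, eventually_sup]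
  exact ⟨⟨hl, hr⟩, eventually_pure.2 le_rfl⟩

end Angle

/-! ### One-sided analytic germs -/

section Germ

/-- `f` agrees along the filter `l` with a function that is real analytic at `θ`. -/
def AnalyticAlong (l : Filter ℝ) (θ : ℝ) (f : ℝ → ℝ) : Prop :=
  ∃ g : ℝ → ℝ, AnalyticAt ℝ g θ ∧ f =ᶠ[l] g

theorem eventually_pow_sign {l : Filter ℝ} {θ : ℝ} (hl : l = 𝓝[<] θ ∨ l = 𝓝[>] θ) (n : ℕ) :
    (∀ᶠ t in l, 0 < (t - θ) ^ n) ∨ ∀ᶠ t in l, (t - θ) ^ n < 0 := by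
  rcases hl with rfl | rfl
  · rcases n.even_or_odd with hn | hn
    · exact Or.inl (eventually_mem_nhdsWithin.mono fun t ht => hn.pow_pos (sub_neg.2 ht).ne)
    · exact Or.inr (eventually_mem_nhdsWithin.mono fun t ht => hn.pow_neg (sub_neg.2 ht))
  · exact Or.inl (eventually_mem_nhdsWithin.mono fun t ht => pow_pos (sub_pos.2 ht) n)

variable {l : Filter ℝ} {θ : ℝ} {f g : ℝ → ℝ}

/-- On one side of `θ`, an analytic function has constant sign near `θ`. -/
theorem AnalyticAlong.nonpos_or_pos (hl : l = 𝓝[<] θ ∨ l = 𝓝[>] θ) (hf : AnalyticAlong l θ f) :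
    (∀ᶠ t in l, f t ≤ 0) ∨ ∀ᶠ t in l, 0 < f t := by
  obtain ⟨g, hg, hfg⟩ := hf
  have hle : l ≤ 𝓝 θ := by rcases hl with rfl | rfl <;> exact nhdsWithin_le_nhds
  by_cases h0 : ∀ᶠ t in 𝓝 θ, g t = 0
  · left
    filter_upwards [hfg, hle h0] with t h1 h2
    rw [h1, h2]
  · obtain ⟨n, h, hh, hne, heq⟩ := hg.exists_eventuallyEq_pow_smul_nonzero_iff.2 h0
    have heq' : ∀ᶠ t in l, f t = (t - θ) ^ n * h t := by
      filter_upwards [hfg, hle heq] with t h1 h2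
      rw [h1, h2, smul_eq_mul]
    rcases lt_or_gt_of_ne hne with hs | hs
    · have hs' := hle (hh.continuousAt.eventually (gt_mem_nhds hs))
      rcases eventually_pow_sign hl n with hp | hp
      · left
        filter_upwards [heq', hs', hp] with t h1 h2 h3
        rw [h1]
        exact (mul_neg_of_pos_of_neg h3 h2).le
      · right
        filter_upwards [heq', hs', hp] with t h1 h2 h3
        rw [h1]
        exact mul_pos_of_neg_of_neg h3 h2
    · have hs' := hle (hh.continuousAt.eventually (lt_mem_nhds hs))
      rcases eventually_pow_sign hl n with hp | hp
      · right
        filter_upwards [heq', hs', hp] with t h1 h2 h3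
        rw [h1]
        exact mul_pos h3 h2
      · left
        filter_upwards [heq', hs', hp] with t h1 h2 h3
        rw [h1]
        exact (mul_neg_of_neg_of_pos h3 h2).le

theorem AnalyticAlong.const (c : ℝ) : AnalyticAlong l θ fun _ => c :=
  ⟨_, analyticAt_const, EventuallyEq.rfl⟩

theorem AnalyticAlong.sub (hf : AnalyticAlong l θ f) (hg : AnalyticAlong l θ g) :
    AnalyticAlong l θ (f - g) := by
  obtain ⟨f', hf', hff'⟩ := hf
  obtain ⟨g', hg', hgg'⟩ := hg
  exact ⟨f' - g', hf'.sub hg', hff'.sub hgg'⟩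

theorem AnalyticAlong.div_const (hf : AnalyticAlong l θ f) (c : ℝ) :
    AnalyticAlong l θ fun t => f t / c := by
  obtain ⟨f', hf', hff'⟩ := hf
  exact ⟨fun t => f' t / c, hf'.div_const, hff'.fun_comp (· / c)⟩

theorem AnalyticAlong.le_or_lt (hl : l = 𝓝[<] θ ∨ l = 𝓝[>] θ) (hf : AnalyticAlong l θ f)
    (hg : AnalyticAlong l θ g) : (∀ᶠ t in l, f t ≤ g t) ∨ ∀ᶠ t in l, g t < f t :=
  ((hf.sub hg).nonpos_or_pos hl).imp (fun h => h.mono fun _ => sub_nonpos.1)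
    fun h => h.mono fun _ => sub_pos.1

theorem AnalyticAlong.sup (hl : l = 𝓝[<] θ ∨ l = 𝓝[>] θ) (hf : AnalyticAlong l θ f)
    (hg : AnalyticAlong l θ g) : AnalyticAlong l θ (f ⊔ g) := by
  rcases hf.le_or_lt hl hg with h | h
  · obtain ⟨g', hg', hgg'⟩ := hg
    exact ⟨g', hg', EventuallyEq.trans (h.mono fun t ht => sup_eq_right.2 ht) hgg'⟩
  · obtain ⟨f', hf', hff'⟩ := hf
    exact ⟨f', hf', EventuallyEq.trans (h.mono fun t ht => sup_eq_left.2 ht.le) hff'⟩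

theorem AnalyticAlong.abs (hl : l = 𝓝[<] θ ∨ l = 𝓝[>] θ) (hf : AnalyticAlong l θ f) :
    AnalyticAlong l θ fun t => |f t| := by
  have := hf.sup hl ((AnalyticAlong.const 0).sub hf)
  convert this using 2 with t
  simp [abs_eq_max_neg]

theorem analyticAlong_insertion (hl : l = 𝓝[<] θ ∨ l = 𝓝[>] θ) (K : Complex2) (α : K.faces) :
    AnalyticAlong l θ fun t => insertion K α (dir t) := by
  have e : (fun t => insertion K α (dir t)) = α.1.sup' (K.nonempty_of_mem_faces α.2)
      fun v t => inner ℝ v (dir t : Plane) := by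
    ext t
    rw [Finset.sup'_apply]
    rfl
  rw [e]
  refine Finset.sup'_induction _ _ (fun f hf g hg => hf.sup hl hg) fun v _ => ?_
  refine ⟨fun t => Real.cos t * v 0 + Real.sin t * v 1, by fun_prop, Eventually.of_forall fun t => ?_⟩
  simp [PiLp.inner_apply, Fin.sum_univ_two, dir]

theorem analyticAlong_diffCurve (hl : l = 𝓝[<] θ ∨ l = 𝓝[>] θ) (K K' : Complex2)
    (p q : K.faces ⊕ K'.faces) : AnalyticAlong l θ fun t => diffCurve K K' p q (dir t) := by
  have h := analyticAlong_insertion hl K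
  have h' := analyticAlong_insertion hl K'
  rcases p with α | σ <;> rcases q with β | τ <;> unfold diffCurve
  · exact (((h α).sub (h β)).abs hl).div_const 2
  · exact ((h α).sub (h' τ)).abs hl
  · exact ((h' σ).sub (h β)).abs hl
  · exact (((h' σ).sub (h' τ)).abs hl).div_const 2

end Germ

/-! ### Curves through a maximum -/

section OneSided

variable (F : Type*) [Field F] (K K' : Complex2) [Finite K.faces] [Finite K'.faces]

/-- If `H` attains its maximum at `dir θ` and is given near `θ` by difference curves, then on either
side of `θ` there is a difference curve through the maximum that stays below it. -/
theorem exists_diffCurve_le {ess : Bool} {S : Finset ℕ} (hfin : dInf F K K' ess S ≠ ⊤) {θ : ℝ}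
    (hθ : H F K K' ess S (dir θ) = dInf F K K' ess S)
    (hV : ∀ᶠ t in 𝓝 θ, H F K K' ess S (dir t) ∈ diffValues K K' (dir t))
    {l : Filter ℝ} (hl : l = 𝓝[<] θ ∨ l = 𝓝[>] θ) :
    ∃ p q : K.faces ⊕ K'.faces, p ≠ q ∧
      diffCurve K K' p q (dir θ) = (dInf F K K' ess S).toReal ∧
      ∀ᶠ t in l, diffCurve K K' p q (dir t) ≤ (dInf F K K' ess S).toReal := by
  have hle : l ≤ 𝓝 θ := by rcases hl with rfl | rfl <;> exact nhdsWithin_le_nhds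
  have : l.NeBot := by rcases hl with rfl | rfl <;> infer_instance
  -- One of the finitely many curves carries the value of `H` at angles arbitrarily close to `θ`.
  obtain ⟨p, q, hpq, hfreq⟩ : ∃ p q : K.faces ⊕ K'.faces, p ≠ q ∧
      ∃ᶠ t in l, ENNReal.ofReal (diffCurve K K' p q (dir t)) = H F K K' ess S (dir t) := by
    by_contra! hcon
    have hall : ∀ᶠ t in l, ∀ p q : K.faces ⊕ K'.faces, p ≠ q →
        ENNReal.ofReal (diffCurve K K' p q (dir t)) ≠ H F K K' ess S (dir t) :=
      eventually_all.2 fun p => eventually_all.2 fun q =>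
        eventually_imp_distrib_left.2 fun hpq => hcon p q hpq
    obtain ⟨t, ⟨p, q, hpq, h⟩, hno⟩ := ((hV.filter_mono hle).and hall).exists
    exact hno p q hpq h
  have hval : ENNReal.ofReal (diffCurve K K' p q (dir θ)) = dInf F K K' ess S := by
    have h1 : Tendsto (fun t => ENNReal.ofReal (diffCurve K K' p q (dir t))) l
        (𝓝 (ENNReal.ofReal (diffCurve K K' p q (dir θ)))) :=
      ((ENNReal.continuous_ofReal.comp
        ((continuous_diffCurve K K' p q).comp continuous_dir)).tendsto θ).mono_left hle
    have h2 : Tendsto (fun t => H F K K' ess S (dir t)) l (𝓝 (H F K K' ess S (dir θ))) :=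
      ((continuousAt_H F K K' ess S (dir θ) (hθ ▸ hfin)).tendsto.comp
        (continuous_dir.tendsto θ)).mono_left hle
    rw [tendsto_nhds_unique_of_frequently_eq h1 h2 hfreq, hθ]
  refine ⟨p, q, hpq, ?_, ?_⟩
  · rw [← hval, ENNReal.toReal_ofReal (diffCurve_nonneg K K' p q _)]
  · refine ((analyticAlong_diffCurve hl K K' p q).le_or_lt hl (AnalyticAlong.const _)).resolve_right
      fun hgt => ?_
    obtain ⟨t, heq, hlt⟩ := (hfreq.and_eventually hgt).exists
    refine hlt.not_ge ((ENNReal.ofReal_le_iff_le_toReal hfin).1 ?_)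
    rw [heq]
    exact le_iSup (H F K K' ess S) _

end OneSided

end PHT

end

theorem mainTheorem4 (F : Type*) [Field F] (K K' : PHT.Complex2)
    [Finite K.faces] [Finite K'.faces] (hK : K.faces.Nonempty) (hK' : K'.faces.Nonempty)
    (ess : Bool) (S : Finset ℕ)
    (hfin : PHT.dInf F K K' ess S ≠ ⊤)
    (hS : (ess = true ∧ 0 ∈ S) ∨ 0 < PHT.dInf F K K' ess S) :
    (∃ ω : PHT.Dir, PHT.H F K K' ess S ω = PHT.dInf F K K' ess S) ∧
    ∀ ω : PHT.Dir, PHT.H F K K' ess S ω = PHT.dInf F K K' ess S →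
      (∃ p q : K.faces ⊕ K'.faces, p ≠ q ∧
        IsLocalMax (PHT.diffCurve K K' p q) ω ∧
        ENNReal.ofReal (PHT.diffCurve K K' p q ω) = PHT.dInf F K K' ess S) ∨
      (∃ p q r s : K.faces ⊕ K'.faces, p ≠ q ∧ r ≠ s ∧
        PHT.IntersectAt (PHT.diffCurve K K' p q) (PHT.diffCurve K K' r s) ω ∧
        ENNReal.ofReal (PHT.diffCurve K K' p q ω) = PHT.dInf F K K' ess S ∧
        ENNReal.ofReal (PHT.diffCurve K K' r s ω) = PHT.dInf F K K' ess S) := by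
  have hle : ∀ ω, PHT.H F K K' ess S ω ≤ PHT.dInf F K K' ess S := le_iSup (PHT.H F K K' ess S)
  have hfin' : ∀ ω, PHT.H F K K' ess S ω ≠ ⊤ := fun ω => ne_top_of_le_ne_top hfin (hle ω)
  have hcont : Continuous (PHT.H F K K' ess S) :=
    continuous_iff_continuousAt.2 fun ω => PHT.continuousAt_H F K K' ess S ω (hfin' ω)
  refine ⟨?_, fun ω hω => ?_⟩
  · have : Nonempty PHT.Dir := ⟨PHT.dir 0⟩
    obtain ⟨ω, -, hω⟩ := isCompact_univ.exists_isMaxOn Set.univ_nonempty hcont.continuousOn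
    exact ⟨ω, le_antisymm (hle ω) (iSup_le fun ω' => hω (Set.mem_univ ω'))⟩
  · obtain ⟨θ, rfl⟩ := PHT.exists_dir_eq ω
    have hV : ∀ᶠ t in 𝓝 θ, PHT.H F K K' ess S (PHT.dir t) ∈ PHT.diffValues K K' (PHT.dir t) := by
      rcases hS with hS | hS
      · exact Eventually.of_forall fun t => PHT.H_mem_diffValues hK (hfin' _) (Or.inl hS)
      · rw [← hω] at hS
        exact ((hcont.comp PHT.continuous_dir).continuousAt.eventually (lt_mem_nhds hS)).mono
          fun t ht => PHT.H_mem_diffValues hK (hfin' _) (Or.inr ht)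
    obtain ⟨p, q, hpq, hpqv, hpql⟩ := PHT.exists_diffCurve_le F K K' hfin hω hV (Or.inl rfl)
    obtain ⟨r, s, hrs, hrsv, hrsr⟩ := PHT.exists_diffCurve_le F K K' hfin hω hV (Or.inr rfl)
    have ofReal_eq : ∀ x : ℝ, x = (PHT.dInf F K K' ess S).toReal →
        ENNReal.ofReal x = PHT.dInf F K K' ess S := by
      rintro _ rfl
      exact ENNReal.ofReal_toReal hfin
    have hpql' := hpql
    have hrsr' := hrsr
    rw [← hpqv] at hpql'
    rw [← hrsv] at hrsr'
    -- If one of the two curves is below the other on the side where only the other one is known to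
    -- stay below the maximum, it has a local maximum. Otherwise the two curves cross.
    rcases (PHT.analyticAlong_diffCurve (Or.inl rfl) K K' r s).le_or_lt (Or.inl rfl)
      (PHT.analyticAlong_diffCurve (l := 𝓝[<] θ) (Or.inl rfl) K K' p q) with hl | hl
    · refine Or.inl ⟨r, s, hrs, PHT.isLocalMax_dir ?_ hrsr', ofReal_eq _ hrsv⟩
      filter_upwards [hl, hpql] with t h1 h2
      rw [hrsv]
      exact h1.trans h2
    · rcases (PHT.analyticAlong_diffCurve (Or.inr rfl) K K' p q).le_or_lt (Or.inr rfl)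
        (PHT.analyticAlong_diffCurve (l := 𝓝[>] θ) (Or.inr rfl) K K' r s) with hr | hr
      · refine Or.inl ⟨p, q, hpq, PHT.isLocalMax_dir hpql' ?_, ofReal_eq _ hpqv⟩
        filter_upwards [hr, hrsr] with t h1 h2
        rw [hpqv]
        exact h1.trans h2
      · exact Or.inr ⟨p, q, r, s, hpq, hrs, ⟨hpqv.trans hrsv.symm, θ, rfl, Or.inl ⟨hl, hr⟩⟩,
          ofReal_eq _ hpqv, ofReal_eq _ hrsv⟩
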